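/- **Conventions.** A *stratified set* is a simplicial set $X$ together with a set of *thin* simplices which contains every degenerate simplex and no $0$-simplex; stratified maps are the simplicial maps which preserve thinness. Let $\mathrm{Strat}$ be the category of stratified sets. The *lax Gray tensor* $X\otimes Y$ of stratified sets has underlying simplicial set $X\times Y$, and an $n$-simplex $(x,y)$ of it is thin iff for every partition $n=p+q$ either the face of $x$ on the vertices $0,\dots,p$ is thin in $X$ or the face of $y$ on the vertices $p,\dots,n$ is thin in $Y$. With unit $\Delta[0]$ and the structure isomorphisms of the cartesian product of simplicial sets this is a monoidal structure on $\mathrm{Strat}$. Write $\mathrm{Strat}_\otimes\text{-}\mathrm{Cat}$ for the category of categories enriched in $(\mathrm{Strat},\otimes,\Delta[0])$ (with composition $\mathcal E(b,c)\otimes\mathcal E(a,b)\to\mathcal E(a,c)$) and enriched functors. Standard simplices $\Delta[n]$ carry the minimal stratification (only degenerate simplices are thin). Let $\bar S$ be the locally ordered category with objects the natural numbers, in which $\bar S(r,s)$ is empty if $s<r$, is $\{()\}$ if $s=r$, and is $\{(a_s,\dots,a_{r+1})\in\{0<1\}^{s-r}\mid a_s=0\}$ with the pointwise order if $r<s$;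 composition is concatenation of tuples. Let $S_\otimes$ be the $\mathrm{Strat}_\otimes$-category whose hom $S_\otimes(r,s)$ has as underlying simplicial set the nerve of $\bar S(r,s)$, stratified as a regular subset of the tensor power $\Delta[1]^{\otimes(s-r)}$ (a simplex is thin iff it is thin there; the factors correspond, from left to right, to the indices $s,s-1,\dots,r+1$). Let $S_\otimes[n]$ be the full enriched subcategory on the objects $0,1,\dots,n$. A simplicial operator $\alpha\colon[n]\to[m]$ induces an enriched functor $S_\otimes[n]\to S_\otimes[m]$, given on objects by $\alpha$ and on homs by the unique functorial, pointwise order preserving action which sends each tuple $\langle r,s\rangle=(0,1,\dots,1)\in\bar S(r,s)$, $r<s$, to $\langle\alpha(r),\alpha(s)\rangle$ (where $\langle t,t\rangle$ is the identity). This gives a functor $S_\otimes[-]\colon\Delta\to\mathrm{Strat}_\otimes\text{-}\mathrm{Cat}$. The *nerve* of a $\mathrm{Strat}_\otimes$-category $\mathcal E$ is the simplicial set $N(\mathcal E)$ whose $n$-simplices are the enriched functors $S_\otimes[n]\to\mathcal E$, with simplicial operators acting by precomposition; enriched functors act on nerves by postcomposition. **Lemma.** The nerve functor $N\colon\mathrm{Strat}_\otimes\text{-}\mathrm{Cat}\to\mathrm{Simp}$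 is faithful. -/

import Mathlib

open CategoryTheory MonoidalCategory Simplicial Opposite

universe u w

namespace StratGray

/-- A stratified set: a simplicial set with a chosen set of thin simplices, containing all
degenerate simplices and no `0`-simplices. -/
structure Strat : Type (u + 1) where
  toSSet : SSet.{u}
  thin : ∀ n : ℕ, Set (toSSet _⦋n⦌)
  degenerate_subset : ∀ n : ℕ, toSSet.degenerate n ⊆ thin n
  thin_zero : thin 0 = ∅

namespace Strat

/-- A stratified map: a simplicial map which preserves thinness. -/
@[ext]
structure Hom (X Y : Strat.{u}) : Type u where
  toMap : X.toSSet ⟶ Y.toSSet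
  map_thin : ∀ (n : ℕ) (x : X.toSSet _⦋n⦌), x ∈ X.thin n → toMap.app (op ⦋n⦌) x ∈ Y.thin n

instance : Category Strat.{u} where
  Hom := Hom
  id X := ⟨𝟙 _, fun _ _ h => h⟩
  comp f g := ⟨f.toMap ≫ g.toMap, fun n x h => g.map_thin n _ (f.map_thin n x h)⟩

/-- The functor forgetting stratifications. -/
def forget : Strat.{u} ⥤ SSet.{u} where
  obj X := X.toSSet
  map f := Hom.toMap f

theorem hom_ext {X Y : Strat.{u}} {f g : X ⟶ Y} (h : Hom.toMap f = Hom.toMap g) : f = g :=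
  Hom.ext h

instance : forget.{u}.Faithful where
  map_injective h := hom_ext h

/-- The minimal stratification: only degenerate simplices are thin. -/
def minimal (X : SSet.{u}) : Strat.{u} where
  toSSet := X
  thin := X.degenerate
  degenerate_subset _ := subset_rfl
  thin_zero := X.degenerate_zero

/-- The stratification on `X` induced along `f : X ⟶ Y`: a simplex is thin when its image is.
When `f` is injective this presents `X` as a regular subset of `Y`. -/
def induced {X : SSet.{u}} {Y : Strat.{u}} (f : X ⟶ Y.toSSet) : Strat.{u} where
  toSSet := X
  thin n := {x | f.app (op ⦋n⦌) x ∈ Y.thin n}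
  degenerate_subset n _ hx := Y.degenerate_subset n (SSet.degenerate_app_apply hx f)
  thin_zero := by
    ext x
    simp [Y.thin_zero]

theorem map_mem_degenerate {X : SSet.{u}} {p m : ℕ} (g : ⦋p⦌ ⟶ ⦋m⦌) (x : X _⦋m⦌)
    (hg : ¬ Function.Injective g.toOrderHom) : X.map g.op x ∈ X.degenerate p := by
  cases p with
  | zero =>
    exact (hg (Function.injective_of_subsingleton (α := Fin 1) _)).elim
  | succ p =>
    obtain ⟨i, θ, rfl⟩ := SimplexCategory.eq_σ_comp_of_not_injective g hg
    exact ⟨p, by omega, SimplexCategory.σ i, X.map θ.op x, by simp⟩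

/-- The lax Gray tensor product. Its underlying simplicial set is the product, and an `n`-simplex
`(x, y)` is thin iff for each partition `p + q = n` either the front `p`-face of `x` is thin or the
back `q`-face of `y` is thin. -/
def laxTensor (X Y : Strat.{u}) : Strat.{u} where
  toSSet := X.toSSet ⊗ Y.toSSet
  thin n := {z | ∀ (p q : ℕ) (h : p + q = n),
    X.toSSet.map (SimplexCategory.subinterval 0 p (by omega)).op z.1 ∈ X.thin p ∨
    Y.toSSet.map (SimplexCategory.subinterval p q (by omega)).op z.2 ∈ Y.thin q}
  degenerate_subset n := by
    rintro z ⟨m, hm, f, ⟨y, rfl⟩⟩ p q h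
    have hf : ¬ Function.Injective f.toOrderHom := fun hi => by
      have := Fintype.card_le_of_injective _ hi
      simp at this
      omega
    by_contra! hcon
    obtain ⟨h1, h2⟩ := hcon
    refine hf (fun a b hab => ?_)
    have e1 : Function.Injective
        (SimplexCategory.subinterval 0 p (by omega : 0 + p ≤ n) ≫ f).toOrderHom := by
      by_contra hc
      refine h1 (X.degenerate_subset _ ?_)
      have := map_mem_degenerate (X := X.toSSet) _ y.1 hc
      rw [op_comp, Functor.map_comp] at this
      exact this
    have e2 : Function.Injective
        (SimplexCategory.subinterval p q (by omega : p + q ≤ n) ≫ f).toOrderHom := by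
      by_contra hc
      refine h2 (Y.degenerate_subset _ ?_)
      have := map_mem_degenerate (X := Y.toSSet) _ y.2 hc
      rw [op_comp, Functor.map_comp] at this
      exact this
    have key : ∀ a b : Fin (n + 1), a < b → f.toOrderHom a ≠ f.toOrderHom b := by
      intro a b hab hfab
      obtain ⟨a, ha⟩ := a
      obtain ⟨b, hb⟩ := b
      have hab' : a < b := hab
      have ha'' : a < n + 1 := ha
      have hb'' : b < n + 1 := hb
      by_cases hp : a < p
      · have hle : f.toOrderHom ⟨a, ha⟩ =
            f.toOrderHom ⟨a + 1, show a + 1 < n + 1 by omega⟩ := by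
          refine le_antisymm (f.toOrderHom.monotone (Fin.mk_le_mk.2 (by omega))) ?_
          rw [hfab]
          exact f.toOrderHom.monotone (Fin.mk_le_mk.2 (by omega))
        have := @e1 ⟨a, by simp; omega⟩ ⟨a + 1, by simp; omega⟩ hle
        simp at this
      · have ha' : a - p + p = a := by omega
        have hb' : b - p + p = b := by omega
        have := @e2 ⟨a - p, by simp; omega⟩ ⟨b - p, by simp; omega⟩ (by
          simp only [SimplexCategory.subinterval]
          refine (congrArg f.toOrderHom (Fin.ext ha')).trans
            (hfab.trans (congrArg f.toOrderHom (Fin.ext hb'.symm))))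
        simp at this
        omega
    by_contra hne
    rcases lt_or_gt_of_ne hne with hlt | hlt
    · exact key a b hlt hab
    · exact key b a hlt hab.symm
  thin_zero := by
    ext z
    simp only [Set.mem_ofPred_eq, Set.mem_empty_iff_false, iff_false, not_forall]
    refine ⟨0, 0, rfl, ?_⟩
    simp [X.thin_zero, Y.thin_zero]

theorem mem_thin_laxTensor {X Y : Strat.{u}} {n : ℕ} (z : (laxTensor X Y).toSSet _⦋n⦌) :
    z ∈ (laxTensor X Y).thin n ↔ ∀ (p q : ℕ) (h : p + q = n),
      X.toSSet.map (SimplexCategory.subinterval 0 p (by omega)).op z.1 ∈ X.thin p ∨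
      Y.toSSet.map (SimplexCategory.subinterval p q (by omega)).op z.2 ∈ Y.thin q :=
  Iff.rfl

/-- The lax Gray tensor of stratified maps. -/
def laxTensorHom {X Y X' Y' : Strat.{u}} (f : X ⟶ X') (g : Y ⟶ Y') :
    laxTensor X Y ⟶ laxTensor X' Y' where
  toMap := Hom.toMap f ⊗ₘ Hom.toMap g
  map_thin n z hz p q h := by
    rcases hz p q h with h1 | h1
    · left
      have := Hom.map_thin f p _ h1
      rw [NatTrans.naturality_apply] at this
      exact this
    · right
      have := Hom.map_thin g q _ h1
      rw [NatTrans.naturality_apply] at this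
      exact this

theorem map_subinterval_comp (X : SSet.{u}) {n a b c d : ℕ} (x : X _⦋n⦌) (h : a + b ≤ n)
    (h' : c + d ≤ b) :
    X.map (SimplexCategory.subinterval c d h').op (X.map (SimplexCategory.subinterval a b h).op x) =
      X.map (SimplexCategory.subinterval (a + c) d (by omega)).op x := by
  rw [← Functor.map_comp_apply, ← op_comp]
  have : SimplexCategory.subinterval c d h' ≫ SimplexCategory.subinterval a b h =
      SimplexCategory.subinterval (a + c) d (by omega) := by
    ext i
    show (i : ℕ) + c + a = (i : ℕ) + (a + c)
    omega
  rw [this]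

theorem map_subinterval_self (X : SSet.{u}) {n : ℕ} (x : X _⦋n⦌) (h : 0 + n ≤ n) :
    X.map (SimplexCategory.subinterval 0 n h).op x = x := by
  have : SimplexCategory.subinterval 0 n h = 𝟙 _ := by
    ext i
    simp [SimplexCategory.subinterval]
  rw [this]
  simp

theorem mem_degenerate_unit {n : ℕ} (x : (𝟙_ SSet.{u}) _⦋n⦌) :
    x ∈ (𝟙_ SSet.{u}).degenerate n ↔ 0 < n := by
  constructor
  · rintro ⟨m, hm, -⟩
    omega
  · intro h
    exact ⟨0, h, ⦋n⦌.const ⦋0⦌ 0, x, rfl⟩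

theorem mem_thin_laxTensor_assoc {X Y Z : Strat.{u}} {n : ℕ}
    (w : (laxTensor (laxTensor X Y) Z).toSSet _⦋n⦌) :
    w ∈ (laxTensor (laxTensor X Y) Z).thin n ↔
      (α_ X.toSSet Y.toSSet Z.toSSet).hom.app (op ⦋n⦌) w ∈
        (laxTensor X (laxTensor Y Z)).thin n := by
  obtain ⟨⟨x, y⟩, z⟩ := w
  constructor
  · intro h p q hpq
    by_cases hP : X.toSSet.map (SimplexCategory.subinterval 0 p (by omega)).op x ∈ X.thin p
    · exact Or.inl hP
    · refine Or.inr (fun p' q' hpq' => ?_)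
      rcases h (p + p') q' (by omega) with h1 | h1
      · have h2 := (h1 p p' rfl).resolve_left (fun h3 => hP (by
          erw [map_subinterval_comp] at h3
          exact h3))
        left
        erw [map_subinterval_comp] at h2 ⊢
        convert h2 using 3
        simp
        rfl
      · right
        erw [map_subinterval_comp]
        exact h1
  · intro h p q hpq
    by_cases hR : Z.toSSet.map (SimplexCategory.subinterval p q (by omega)).op z ∈ Z.thin q
    · exact Or.inr hR
    · refine Or.inl (fun p' q' hpq' => ?_)
      rcases h p' (q' + q) (by omega) with h1 | h1
      · left
        erw [map_subinterval_comp]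
        exact h1
      · have h2 := (h1 q' q rfl).resolve_right (fun h3 => hR (by
          subst hpq'
          erw [map_subinterval_comp] at h3
          exact h3))
        right
        erw [map_subinterval_comp] at h2 ⊢
        convert h2 using 3
        simp
        rfl

/-- The unit `Δ[0]` of the lax Gray tensor product. -/
def unit : Strat.{u} := minimal (𝟙_ SSet.{u})

theorem mem_thin_unit_laxTensor {X : Strat.{u}} {n : ℕ}
    (z : (laxTensor unit X).toSSet _⦋n⦌) :
    z ∈ (laxTensor unit X).thin n ↔ (λ_ X.toSSet).hom.app (op ⦋n⦌) z ∈ X.thin n := by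
  obtain ⟨t, x⟩ := z
  constructor
  · intro h
    rcases h 0 n (by omega) with h1 | h1
    · exact (((mem_degenerate_unit _).1 h1).ne rfl).elim
    · erw [map_subinterval_self] at h1
      exact h1
  · intro h p q hpq
    rcases Nat.eq_zero_or_pos p with rfl | hp
    · right
      obtain rfl : q = n := by omega
      erw [map_subinterval_self]
      exact h
    · exact Or.inl ((mem_degenerate_unit _).2 hp)

theorem mem_thin_laxTensor_unit {X : Strat.{u}} {n : ℕ}
    (z : (laxTensor X unit).toSSet _⦋n⦌) :
    z ∈ (laxTensor X unit).thin n ↔ (ρ_ X.toSSet).hom.app (op ⦋n⦌) z ∈ X.thin n := by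
  obtain ⟨x, t⟩ := z
  constructor
  · intro h
    rcases h n 0 (by omega) with h1 | h1
    · erw [map_subinterval_self] at h1
      exact h1
    · exact (((mem_degenerate_unit _).1 h1).ne rfl).elim
  · intro h p q hpq
    rcases Nat.eq_zero_or_pos q with rfl | hq
    · left
      obtain rfl : p = n := by omega
      erw [map_subinterval_self]
      exact h
    · exact Or.inr ((mem_degenerate_unit _).2 hq)

/-- An isomorphism of underlying simplicial sets which preserves and reflects thinness. -/
def isoMk {X Y : Strat.{u}} (e : X.toSSet ≅ Y.toSSet)
    (h : ∀ (n : ℕ) (x : X.toSSet _⦋n⦌), x ∈ X.thin n ↔ e.hom.app (op ⦋n⦌) x ∈ Y.thin n) :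
    X ≅ Y where
  hom := ⟨e.hom, fun n x => (h n x).1⟩
  inv := ⟨e.inv, fun n y hy => (h n _).2 (by
    have : e.hom.app (op ⦋n⦌) (e.inv.app (op ⦋n⦌) y) = y := by simp
    rwa [this])⟩
  hom_inv_id := hom_ext e.hom_inv_id
  inv_hom_id := hom_ext e.inv_hom_id

instance : MonoidalCategoryStruct Strat.{u} where
  tensorObj := laxTensor
  tensorHom f g := laxTensorHom f g
  whiskerLeft X _ _ g := laxTensorHom (𝟙 X) g
  whiskerRight f Y := laxTensorHom f (𝟙 Y)
  tensorUnit := unit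
  associator X Y Z :=
    isoMk (α_ X.toSSet Y.toSSet Z.toSSet) (fun _ => mem_thin_laxTensor_assoc)
  leftUnitor X := isoMk (λ_ X.toSSet) (fun _ => mem_thin_unit_laxTensor)
  rightUnitor X := isoMk (ρ_ X.toSSet) (fun _ => mem_thin_laxTensor_unit)

/-- The monoidal category `(Strat, ⊗, Δ[0])`: the forgetful functor to simplicial sets with the
cartesian product is strict monoidal. -/
instance : MonoidalCategory Strat.{u} :=
  Monoidal.induced forget
    { μIso := fun _ _ => Iso.refl _
      εIso := Iso.refl _
      whiskerLeft_eq := fun X _ _ f => by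
        show 𝟙 X.toSSet ⊗ₘ Hom.toMap f = 𝟙 _ ≫ (X.toSSet ◁ Hom.toMap f) ≫ 𝟙 _
        simp
      whiskerRight_eq := fun f X => by
        show Hom.toMap f ⊗ₘ 𝟙 X.toSSet = 𝟙 _ ≫ (Hom.toMap f ▷ X.toSSet) ≫ 𝟙 _
        simp
      tensorHom_eq := fun _ _ => rfl
      associator_eq := fun X Y Z => by
        show (α_ X.toSSet Y.toSSet Z.toSSet).hom =
          ((𝟙 _ ≫ (𝟙 _ ⊗ₘ 𝟙 _)) ≫ (α_ X.toSSet Y.toSSet Z.toSSet).hom ≫ ((𝟙 _ ⊗ₘ 𝟙 _) ≫ 𝟙 _))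
        simp
      leftUnitor_eq := fun X => by
        show (λ_ X.toSSet).hom = (𝟙 _ ≫ (𝟙 _ ⊗ₘ 𝟙 _)) ≫ (λ_ X.toSSet).hom
        simp
      rightUnitor_eq := fun X => by
        show (ρ_ X.toSSet).hom = (𝟙 _ ≫ (𝟙 _ ⊗ₘ 𝟙 _)) ≫ (ρ_ X.toSSet).hom
        simp }

end Strat
end StratGray

namespace StratGray

/-! ### Homotopy coherent paths -/

/-- An arrow `r ⟶ s` of the locally ordered category of homotopy coherent paths: a tuple
`(a_s, …, a_{r+1})` of elements of `[1]` with `a_s = 0` if `r < s`. The tuple is recorded as a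
function on `ℕ` which takes the value `1` outside of the index set `(r, s]`. -/
@[ext]
structure PathHom (r s : ℕ) : Type where
  coord : ℕ → Fin 2
  le : r ≤ s
  coord_eq_one : ∀ i, ¬ (r < i ∧ i ≤ s) → coord i = 1
  coord_last : r < s → coord s = 0

namespace PathHom

/-- Tuples are ordered pointwise. -/
instance (r s : ℕ) : PartialOrder (PathHom r s) :=
  PartialOrder.lift coord (fun _ _ h => PathHom.ext h)

theorem le_def {r s : ℕ} (a b : PathHom r s) : a ≤ b ↔ ∀ i, a.coord i ≤ b.coord i := Iff.rfl

/-- The identity is the empty tuple. -/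
def id (r : ℕ) : PathHom r r where
  coord _ := 1
  le := le_rfl
  coord_eq_one _ _ := rfl
  coord_last h := (lt_irrefl r h).elim

/-- Composition is concatenation of tuples; since `a` is `1` outside of `(r, s]` and `b` is `1`
outside of `(s, t]`, the concatenation is the pointwise minimum. -/
def comp {r s t : ℕ} (b : PathHom s t) (a : PathHom r s) : PathHom r t where
  coord i := b.coord i ⊓ a.coord i
  le := a.le.trans b.le
  coord_eq_one i hi := by
    have h1 := a.le
    have h2 := b.le
    rw [b.coord_eq_one i (by omega), a.coord_eq_one i (by omega)]
    rfl
  coord_last h := by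
    rcases b.le.eq_or_lt with rfl | h'
    · rw [a.coord_last h]
      exact min_eq_right (Fin.zero_le _)
    · rw [b.coord_last h']
      exact min_eq_left (Fin.zero_le _)

theorem fin_two_ext {x y : Fin 2} (h : x = 0 ↔ y = 0) : x = y := by
  revert x y; decide

theorem ext_zero {r s : ℕ} {a b : PathHom r s} (h : ∀ i, a.coord i = 0 ↔ b.coord i = 0) :
    a = b :=
  PathHom.ext (funext fun i => fin_two_ext (h i))

theorem le_iff_zero {r s : ℕ} {a b : PathHom r s} :
    a ≤ b ↔ ∀ i, b.coord i = 0 → a.coord i = 0 := by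
  have : ∀ x y : Fin 2, x ≤ y ↔ (y = 0 → x = 0) := by decide
  exact forall_congr' fun i => this _ _

theorem comp_coord_eq_zero {r s t : ℕ} (b : PathHom s t) (a : PathHom r s) (i : ℕ) :
    (comp b a).coord i = 0 ↔ b.coord i = 0 ∨ a.coord i = 0 := by
  have : ∀ x y : Fin 2, x ⊓ y = 0 ↔ x = 0 ∨ y = 0 := by decide
  exact this _ _

theorem mem_of_coord_eq_zero {r s : ℕ} (a : PathHom r s) {i : ℕ} (h : a.coord i = 0) :
    r < i ∧ i ≤ s := by
  by_contra hi
  rw [a.coord_eq_one i hi] at h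
  exact absurd h (by decide)

theorem coord_eq_one_iff {r s : ℕ} (a : PathHom r s) (i : ℕ) :
    a.coord i = 1 ↔ ¬ a.coord i = 0 := by
  have : ∀ x : Fin 2, x = 1 ↔ ¬ x = 0 := by decide
  exact this _

open Classical in
/-- The action of a simplicial operator `α : [n] ⟶ [m]` on arrows: the ordinate at index `j` of
the image of `(a_s, …, a_{r+1})` is the minimum of the ordinates `a_i` with `α(i) = j`, and it is
`1` if there are none. This sends each indecomposable `⟨r, s⟩ = (0, 1, …, 1)` to
`⟨α(r), α(s)⟩`, and it preserves composition. -/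
noncomputable def map {n m : SimplexCategory} (α : n ⟶ m) {r s : Fin (n.len + 1)}
    (a : PathHom r s) : PathHom (α.toOrderHom r) (α.toOrderHom s) where
  coord j :=
    if α.toOrderHom r < j ∧ ∃ i : Fin (n.len + 1), (α.toOrderHom i : ℕ) = j ∧ a.coord i = 0
    then 0 else 1
  le := α.toOrderHom.monotone a.le
  coord_eq_one j hj := by
    rw [if_neg]
    rintro ⟨h1, i, rfl, hi⟩
    exact hj ⟨h1, α.toOrderHom.monotone (a.mem_of_coord_eq_zero hi).2⟩
  coord_last h := by
    rw [if_pos]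
    refine ⟨h, s, rfl, a.coord_last ?_⟩
    by_contra hrs
    exact absurd (α.toOrderHom.monotone (not_lt.1 hrs : s ≤ r)) (not_le.2 h)

theorem map_coord_eq_zero {n m : SimplexCategory} (α : n ⟶ m) {r s : Fin (n.len + 1)}
    (a : PathHom r s) (j : ℕ) :
    (map α a).coord j = 0 ↔ (α.toOrderHom r : ℕ) < j ∧
      ∃ i : Fin (n.len + 1), (α.toOrderHom i : ℕ) = j ∧ a.coord i = 0 := by
  classical
  simp only [map]
  split_ifs with h
  · exact ⟨fun _ => h, fun _ => rfl⟩
  · exact ⟨fun h' => absurd h' (by decide), fun h' => (h h').elim⟩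

theorem map_mono {n m : SimplexCategory} (α : n ⟶ m) {r s : Fin (n.len + 1)} :
    Monotone (map α : PathHom r s → _) := by
  intro a b h
  rw [le_iff_zero] at h ⊢
  intro j hj
  rw [map_coord_eq_zero] at hj ⊢
  obtain ⟨h1, i, h2, h3⟩ := hj
  exact ⟨h1, i, h2, h _ h3⟩

theorem map_id_path {n m : SimplexCategory} (α : n ⟶ m) (r : Fin (n.len + 1)) :
    map α (id (r : ℕ)) = id _ := by
  refine ext_zero fun j => ?_
  rw [map_coord_eq_zero]
  simp [id]

theorem map_comp_path {n m : SimplexCategory} (α : n ⟶ m) {r s t : Fin (n.len + 1)}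
    (b : PathHom s t) (a : PathHom r s) : map α (comp b a) = comp (map α b) (map α a) := by
  refine ext_zero fun j => ?_
  simp only [map_coord_eq_zero, comp_coord_eq_zero]
  constructor
  · rintro ⟨h1, i, rfl, h2 | h2⟩
    · by_cases hs : (α.toOrderHom s : ℕ) < α.toOrderHom i
      · exact Or.inl ⟨hs, i, rfl, h2⟩
      · right
        have hsi : α.toOrderHom s ≤ α.toOrderHom i :=
          α.toOrderHom.monotone (b.mem_of_coord_eq_zero h2).1.le
        have he : (α.toOrderHom s : ℕ) = α.toOrderHom i := le_antisymm hsi (not_lt.1 hs)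
        refine ⟨h1, s, he, a.coord_last ?_⟩
        by_contra hrs
        have := α.toOrderHom.monotone (not_lt.1 hrs : s ≤ r)
        have : (α.toOrderHom s : ℕ) ≤ α.toOrderHom r := this
        omega
    · exact Or.inr ⟨h1, i, rfl, h2⟩
  · rintro (⟨h1, i, h2, h3⟩ | ⟨h1, i, h2, h3⟩)
    · exact ⟨lt_of_le_of_lt (α.toOrderHom.monotone a.le) h1, i, h2, Or.inl h3⟩
    · exact ⟨h1, i, h2, Or.inr h3⟩

theorem id_map {n : SimplexCategory} {r s : Fin (n.len + 1)} (a : PathHom r s) :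
    map (𝟙 n) a = a := by
  refine ext_zero fun j => ?_
  rw [map_coord_eq_zero]
  constructor
  · rintro ⟨-, i, rfl, h⟩
    exact h
  · intro h
    have hj := a.mem_of_coord_eq_zero h
    exact ⟨hj.1, ⟨j, by omega⟩, rfl, h⟩

theorem comp_map {n m k : SimplexCategory} (α : n ⟶ m) (β : m ⟶ k) {r s : Fin (n.len + 1)}
    (a : PathHom r s) : map (α ≫ β) a = map β (map α a) := by
  refine ext_zero fun j => ?_
  erw [map_coord_eq_zero, map_coord_eq_zero]
  constructor
  · rintro ⟨h1, i, h2, h3⟩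
    refine ⟨h1, α.toOrderHom i, h2, (map_coord_eq_zero _ _ _).2 ⟨?_, i, rfl, h3⟩⟩
    by_contra hlt
    have : (β.toOrderHom (α.toOrderHom i) : ℕ) ≤ β.toOrderHom (α.toOrderHom r) :=
      β.toOrderHom.monotone (not_lt.1 hlt : α.toOrderHom i ≤ α.toOrderHom r)
    have h1' : (β.toOrderHom (α.toOrderHom r) : ℕ) < j := h1
    have h2' : (β.toOrderHom (α.toOrderHom i) : ℕ) = j := h2
    omega
  · rintro ⟨h1, k, h2, h3⟩
    obtain ⟨-, i, h5, h6⟩ := (map_coord_eq_zero _ _ _).1 h3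
    have : k = α.toOrderHom i := Fin.ext h5.symm
    subst this
    exact ⟨h1, i, h2, h6⟩

end PathHom

/-- The simplicial set of arrows `r ⟶ s` in the simplicially enriched category of homotopy
coherent paths: the categorical nerve of the ordered set of tuples. -/
abbrev pathSSet (r s : ℕ) : SSet.{u} := nerve (ULift.{u} (PathHom r s))

/-- The `i`-th ordinate of a simplex of tuples, as a simplex of `Δ[1]`. -/
def ordinate (r s i : ℕ) : pathSSet.{u} r s ⟶ Δ[1] where
  app _ := ↾fun x => SSet.stdSimplex.objMk
    ⟨fun v => (x.obj v).down.coord i, fun _ _ h => x.monotone h i⟩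
  naturality _ _ _ := rfl

/-- The `k`-fold tensor power of `Δ[1]` (minimally stratified). -/
def cube (k : ℕ) : Strat.{u} :=
  match k with
  | 0 => 𝟙_ Strat.{u}
  | k + 1 => Strat.minimal Δ[1] ⊗ cube k

/-- The simplicial map `(α_s, …, α_{r+1}) ↦ (α_{r+k}, …, α_{r+1})` from the simplicial set of
tuples to the simplicial set underlying the `k`-fold tensor power of `Δ[1]`. -/
def toCube (r s k : ℕ) : pathSSet.{u} r s ⟶ (cube.{u} k).toSSet :=
  match k with
  | 0 => CartesianMonoidalCategory.toUnit (pathSSet.{u} r s)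
  | k + 1 => CartesianMonoidalCategory.lift (ordinate r s (r + k + 1)) (toCube r s k)

/-- The stratified set of arrows `r ⟶ s` of homotopy coherent paths, as a regular subset of the
`(s - r)`-fold tensor power of `Δ[1]`. -/
def pathStrat (r s : ℕ) : Strat.{u} := Strat.induced (toCube.{u} r s (s - r))

end StratGray

namespace StratGray

theorem interval_notMem_thin {m : ℕ} (x : (Δ[1] : SSet.{u}) _⦋m⦌) :
    x ∉ (Strat.minimal.{u} Δ[1]).thin m ↔
      m ≤ 1 ∧ ∀ (h : 1 ≤ m), x ⟨0, by omega⟩ = 0 ∧ x ⟨1, by omega⟩ = 1 := by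
  show x ∈ SSet.nonDegenerate _ m ↔ _
  rw [SSet.stdSimplex.mem_nonDegenerate_iff_strictMono]
  constructor
  · intro hx
    have hm : m ≤ 1 := by
      have := Fintype.card_le_of_injective _ hx.injective
      simpa using this
    refine ⟨hm, fun h => ?_⟩
    have : ∀ a b : Fin 2, a < b → a = 0 ∧ b = 1 := by decide
    exact this _ _ (hx (Fin.mk_lt_mk.2 Nat.zero_lt_one))
  · rintro ⟨hm, h⟩ ⟨i, hi⟩ ⟨j, hj⟩ hij
    have hij' : i < j := hij
    obtain ⟨rfl, rfl⟩ : i = 0 ∧ j = 1 := by omega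
    have := h (by omega)
    show x _ < x _
    rw [this.1, this.2]
    decide

/-- A simplex of tuples is non-thin iff it jumps, at its successive steps, at a strictly
decreasing sequence of ordinates. -/
theorem toCube_notMem_thin (r s k : ℕ) : ∀ {m : ℕ} (x : (pathSSet.{u} r s) _⦋m⦌),
    (toCube.{u} r s k).app (op ⦋m⦌) x ∉ (cube.{u} k).thin m ↔
      ∃ f : ℕ → ℕ, (∀ l l', l < l' → l' < m → f l' < f l) ∧
        ∀ (l : ℕ) (h : l < m), r < f l ∧ f l ≤ r + k ∧
          (x.obj ⟨l, by simp; omega⟩).down.coord (f l) = 0 ∧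
          (x.obj ⟨l + 1, by simp; omega⟩).down.coord (f l) = 1 := by
  induction k with
  | zero =>
    intro m x
    have : (toCube.{u} r s 0).app (op ⦋m⦌) x ∈ (cube.{u} 0).thin m ↔ 0 < m :=
      Strat.mem_degenerate_unit _
    rw [this]
    constructor
    · intro h
      exact ⟨fun _ => 0, fun l l' _ h' => by omega, fun l h' => by omega⟩
    · rintro ⟨f, -, hf⟩ h
      have := hf 0 h
      omega
  | succ k ih =>
    intro m x
    have h0 : (toCube.{u} r s (k + 1)).app (op ⦋m⦌) x ∉ (cube.{u} (k + 1)).thin m ↔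
        ∃ (p q : ℕ) (h : p + q = m),
          (ordinate r s (r + k + 1)).app (op ⦋p⦌)
            ((pathSSet.{u} r s).map (SimplexCategory.subinterval 0 p (by omega)).op x) ∉
            (Strat.minimal.{u} Δ[1]).thin p ∧
          (toCube.{u} r s k).app (op ⦋q⦌)
            ((pathSSet.{u} r s).map (SimplexCategory.subinterval p q (by omega)).op x) ∉
            (cube.{u} k).thin q := by
      rw [← not_iff_not]
      push Not
      refine Iff.trans (Strat.mem_thin_laxTensor _) ?_
      refine forall_congr' fun p => forall_congr' fun q => forall_congr' fun h => ?_
      rw [NatTrans.naturality_apply, NatTrans.naturality_apply]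
      exact or_iff_not_imp_left
    rw [h0]
    constructor
    · rintro ⟨p, q, rfl, h1, h2⟩
      rw [interval_notMem_thin] at h1
      rw [ih] at h2
      obtain ⟨hp, h1⟩ := h1
      obtain ⟨f, hf, h2⟩ := h2
      refine ⟨fun l => if l < p then r + k + 1 else f (l - p), ?_, ?_⟩
      · intro l l' hl hl'
        have : ¬ l' < p → f (l' - p) ≤ r + k := fun h => (h2 (l' - p) (by omega)).2.1
        have := hf (l - p) (l' - p)
        dsimp only
        split_ifs <;> omega
      · intro l hl
        dsimp only
        split_ifs with hlp
        · obtain rfl : l = 0 := by omega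
          obtain rfl : p = 1 := by omega
          exact ⟨by omega, by omega, h1 le_rfl⟩
        · obtain ⟨l, rfl⟩ := Nat.exists_eq_add_of_le' (not_lt.1 hlp)
          have h3 := h2 l (by omega)
          simp only [Nat.add_sub_cancel]
          refine ⟨h3.1, by omega, h3.2.2.1, ?_⟩
          have h4 := h3.2.2.2
          have e : l + 1 + p = l + p + 1 := by omega
          refine Eq.trans ?_ h4
          refine congrArg (fun v => (x.obj v).down.coord (f l)) (Fin.ext e.symm)
    · rintro ⟨f, hf, h2⟩
      by_cases hm : 0 < m ∧ f 0 = r + k + 1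
      · obtain ⟨hm, hf0⟩ := hm
        obtain ⟨q, rfl⟩ := Nat.exists_eq_add_of_le (show 1 ≤ m from hm)
        refine ⟨1, q, rfl, ?_, ?_⟩
        · rw [interval_notMem_thin]
          refine ⟨le_rfl, fun _ => ?_⟩
          have := (h2 0 hm).2.2
          rw [hf0] at this
          exact this
        · rw [ih]
          refine ⟨fun l => f (l + 1), fun l l' h h' => hf _ _ (by omega) (by omega), ?_⟩
          intro l hl
          have h3 := h2 (l + 1) (by omega)
          have := hf 0 (l + 1) (by omega) (by omega)
          exact ⟨h3.1, show f (l + 1) ≤ r + k by omega, h3.2.2⟩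
      · refine ⟨0, m, by omega, ?_, ?_⟩
        · rw [interval_notMem_thin]
          exact ⟨by omega, fun h => by omega⟩
        · rw [ih]
          refine ⟨f, hf, fun l hl => ?_⟩
          have h3 := h2 l hl
          refine ⟨h3.1, ?_, h3.2.2⟩
          rcases Nat.eq_zero_or_pos l with rfl | hl0
          · have : f 0 ≠ r + k + 1 := fun h => hm ⟨hl, h⟩
            omega
          · have := hf 0 l hl0 hl
            have := (h2 0 (by omega)).2.1
            omega

theorem pathStrat_notMem_thin {r s m : ℕ} (x : (pathSSet.{u} r s) _⦋m⦌) :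
    x ∉ (pathStrat.{u} r s).thin m ↔
      ∃ f : ℕ → ℕ, (∀ l l', l < l' → l' < m → f l' < f l) ∧
        ∀ (l : ℕ) (h : l < m),
          (x.obj ⟨l, by simp; omega⟩).down.coord (f l) = 0 ∧
          (x.obj ⟨l + 1, by simp; omega⟩).down.coord
            (f l) = 1 := by
  refine (toCube_notMem_thin.{u} r s (s - r) x).trans ?_
  refine exists_congr fun f => and_congr_right fun _ => forall_congr' fun l =>
    forall_congr' fun h => ⟨fun h' => h'.2.2, fun h' => ?_⟩
  have := PathHom.mem_of_coord_eq_zero _ h'.1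
  exact ⟨by omega, by omega, h'⟩

/-- Composition `S(s, t) ⊗ S(r, s) ⟶ S(r, t)` of homotopy coherent paths: pointwise
concatenation of tuples. -/
def pathCompMap (r s t : ℕ) : pathSSet.{u} s t ⊗ pathSSet.{u} r s ⟶ pathSSet.{u} r t where
  app _ := ↾fun x => Monotone.functor
    (f := fun v => ULift.up (PathHom.comp (x.1.obj v).down (x.2.obj v).down))
    (fun _ _ h i => min_le_min (x.1.monotone h i) (x.2.monotone h i))
  naturality _ _ _ := rfl

/-- The composition is stratified. -/
def pathComp (r s t : ℕ) : pathStrat.{u} s t ⊗ pathStrat.{u} r s ⟶ pathStrat.{u} r t where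
  toMap := pathCompMap r s t
  map_thin m z hz := by
    obtain ⟨b, a⟩ := z
    change (pathSSet.{u} s t) _⦋m⦌ at b
    change (pathSSet.{u} r s) _⦋m⦌ at a
    by_contra hcon
    obtain ⟨f, hf, h⟩ := (pathStrat_notMem_thin _).1 hcon
    have h0 : ∀ (l : ℕ) (hl : l < m),
        (b.obj ⟨l, by simp; omega⟩).down.coord (f l) = 0 ∨
          (a.obj ⟨l, by simp; omega⟩).down.coord (f l) = 0 := fun l hl =>
      (PathHom.comp_coord_eq_zero _ _ _).1 (h l hl).1
    have h1 : ∀ (l : ℕ) (hl : l < m),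
        (b.obj ⟨l + 1, by simp; omega⟩).down.coord (f l) = 1 ∧
          (a.obj ⟨l + 1, by simp; omega⟩).down.coord (f l) = 1 := fun l hl => by
      have := ((PathHom.coord_eq_one_iff _ _).1 (h l hl).2)
      have h' := not_or.1 fun h'' => this ((PathHom.comp_coord_eq_zero _ _ _).2 h'')
      exact ⟨(PathHom.coord_eq_one_iff _ _).2 h'.1, (PathHom.coord_eq_one_iff _ _).2 h'.2⟩
    classical
    have hex : ∃ p, m ≤ p ∨ f p ≤ s := ⟨m, Or.inl le_rfl⟩
    obtain ⟨p, hp, hmin⟩ : ∃ p, (m ≤ p ∨ f p ≤ s) ∧ ∀ l < p, ¬ (m ≤ l ∨ f l ≤ s) :=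
      ⟨Nat.find hex, Nat.find_spec hex, fun l hl => Nat.find_min hex hl⟩
    have hpm : p ≤ m := by
      by_contra hlt
      exact hmin m (by omega) (Or.inl le_rfl)
    obtain ⟨q, rfl⟩ := Nat.exists_eq_add_of_le hpm
    rcases hz p q rfl with h2 | h2
    · refine (pathStrat_notMem_thin _).2 ?_ h2
      refine ⟨f, fun l l' hl hl' => hf l l' hl (by omega), fun l hl => ?_⟩
      refine ⟨(h0 l (by omega)).resolve_right fun h3 => ?_, (h1 l (by omega)).1⟩
      have := PathHom.mem_of_coord_eq_zero _ h3
      exact hmin l hl (Or.inr this.2)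
    · refine (pathStrat_notMem_thin _).2 ?_ h2
      refine ⟨fun l => f (l + p), fun l l' hl hl' => hf _ _ (by omega) (by omega),
        fun l hl => ?_⟩
      refine ⟨(h0 (l + p) (by omega)).resolve_left fun h3 => ?_, ?_⟩
      · have := PathHom.mem_of_coord_eq_zero _ h3
        rcases Nat.eq_zero_or_pos l with rfl | hl0
        · rw [zero_add] at this
          omega
        · have := hf p (l + p) (by omega) (by omega)
          omega
      · refine Eq.trans ?_ (h1 (l + p) (by omega)).2
        exact congrArg (fun v => (a.obj v).down.coord (f (l + p)))
          (Fin.ext (show l + 1 + p = l + p + 1 by omega))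

/-- The identity arrow at `r`. -/
def pathId (r : ℕ) : 𝟙_ Strat.{u} ⟶ pathStrat.{u} r r where
  toMap :=
    { app := fun _ => ↾fun _ => Monotone.functor (f := fun _ => ULift.up (PathHom.id r))
        (fun _ _ _ => le_rfl)
      naturality := fun _ _ _ => rfl }
  map_thin _ _ hx := (pathStrat r r).degenerate_subset _ (SSet.degenerate_app_apply hx _)

/-- The action of a simplicial operator on the stratified sets of arrows. -/
noncomputable def pathMap {n m : SimplexCategory} (α : n ⟶ m) (r s : Fin (n.len + 1)) :
    pathStrat.{u} r s ⟶ pathStrat.{u} (α.toOrderHom r) (α.toOrderHom s) where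
  toMap := nerveMap (Monotone.functor (f := fun a => ULift.up (PathHom.map α a.down))
    (fun _ _ h => PathHom.map_mono α h))
  map_thin k x hx := by
    change (pathSSet.{u} r s) _⦋k⦌ at x
    by_contra hcon
    obtain ⟨f, hf, h⟩ := (pathStrat_notMem_thin _).1 hcon
    refine (pathStrat_notMem_thin _).2 ?_ hx
    have h0 : ∀ (l : ℕ) (hl : l < k), ∃ i : Fin (n.len + 1),
        (α.toOrderHom i : ℕ) = f l ∧ (x.obj ⟨l, by simp; omega⟩).down.coord i = 0 ∧
          (x.obj ⟨l + 1, by simp; omega⟩).down.coord i = 1 := fun l hl => by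
      obtain ⟨h1, i, h2, h3⟩ := (PathHom.map_coord_eq_zero α _ _).1 (h l hl).1
      refine ⟨i, h2, h3, (PathHom.coord_eq_one_iff _ _).2 fun h4 => ?_⟩
      exact (PathHom.coord_eq_one_iff _ _).1 (h l hl).2
        ((PathHom.map_coord_eq_zero α _ _).2 ⟨h1, i, h2, h4⟩)
    choose! g hg using h0
    refine ⟨fun l => g l, fun l l' hl hl' => ?_, fun l hl => (hg l hl).2⟩
    by_contra hlt
    have h1 : α.toOrderHom (g l) ≤ α.toOrderHom (g l') := α.toOrderHom.monotone (not_lt.1 hlt)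
    have h2 : (α.toOrderHom (g l) : ℕ) ≤ α.toOrderHom (g l') := h1
    rw [(hg l (by omega)).1, (hg l' hl').1] at h2
    have := hf l l' hl hl'
    omega

theorem PathHom.comp_id {r s : ℕ} (a : PathHom r s) : comp a (id r) = a := by
  refine ext_zero fun i => ?_
  rw [comp_coord_eq_zero]
  simp [id]

theorem PathHom.id_comp {r s : ℕ} (a : PathHom r s) : comp (id s) a = a := by
  refine ext_zero fun i => ?_
  rw [comp_coord_eq_zero]
  simp [id]

theorem PathHom.comp_assoc {q r s t : ℕ} (c : PathHom s t) (b : PathHom r s) (a : PathHom q r) :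
    comp (comp c b) a = comp c (comp b a) := by
  refine ext_zero fun i => ?_
  simp only [comp_coord_eq_zero, or_assoc]

theorem pathStrat_hom_ext {X : Strat.{u}} {r s : ℕ} {f g : X ⟶ pathStrat.{u} r s}
    (h : ∀ (m : SimplexCategoryᵒᵖ) (x : X.toSSet.obj m) (v : Fin (m.unop.len + 1)),
      ((Strat.Hom.toMap f).app m x : (pathSSet.{u} r s).obj m).obj v =
        ((Strat.Hom.toMap g).app m x : (pathSSet.{u} r s).obj m).obj v) : f = g := by
  refine Strat.hom_ext ?_
  ext m x
  exact nerve.ext_of_isThin (funext fun v => h m x v)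

/-- The objects of the generic homotopy coherent `n`-path: the elements of the ordinal `[n]`. -/
def PathObj (n : SimplexCategory) : Type := Fin (n.len + 1)

/-- The underlying natural number of an object. -/
def PathObj.val {n : SimplexCategory} (r : PathObj n) : ℕ := Fin.val (n := n.len + 1) r

/-- The generic homotopy coherent `n`-path as a category enriched in stratified sets for the lax
Gray tensor product. The composition is a map `S(s, t) ⊗ S(r, s) ⟶ S(r, t)`; since enriched
categories in Mathlib compose in the order `Hom(r, s) ⊗ Hom(s, t)`, they are taken over the monoidal
opposite of `(Strat, ⊗, Δ[0])`. -/
instance (n : SimplexCategory) : EnrichedCategory Strat.{u}ᴹᵒᵖ (PathObj n) where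
  Hom r s := .mop (pathStrat.{u} r.val s.val)
  id r := (pathId r.val).mop
  comp r s t := (pathComp r.val s.val t.val).mop
  id_comp _ _ := MonoidalOpposite.hom_ext (pathStrat_hom_ext fun _ _ _ =>
    congrArg ULift.up (PathHom.comp_id _))
  comp_id _ _ := MonoidalOpposite.hom_ext (pathStrat_hom_ext fun _ _ _ =>
    congrArg ULift.up (PathHom.id_comp _))
  assoc _ _ _ _ := MonoidalOpposite.hom_ext (pathStrat_hom_ext fun _ _ _ =>
    congrArg ULift.up (PathHom.comp_assoc _ _ _).symm)

/-- The enriched functor between generic homotopy coherent paths induced by a simplicial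
operator. -/
noncomputable def pathFunctor {n m : SimplexCategory} (α : n ⟶ m) :
    EnrichedFunctor Strat.{u}ᴹᵒᵖ (PathObj n) (PathObj m) where
  obj r := α.toOrderHom r
  map r s := (pathMap.{u} α r s).mop
  map_id _ := MonoidalOpposite.hom_ext (pathStrat_hom_ext fun _ _ _ =>
    congrArg ULift.up (PathHom.map_id_path α _))
  map_comp _ _ _ := MonoidalOpposite.hom_ext (pathStrat_hom_ext fun _ _ _ =>
    congrArg ULift.up (PathHom.map_comp_path α _ _))

section

variable {V : Type*} [Category* V] [MonoidalCategory V]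
  {C : Type*} [EnrichedCategory V C] {D : Type*} [EnrichedCategory V D]
  {E : Type*} [EnrichedCategory V E] {E' : Type*} [EnrichedCategory V E']

theorem enrichedFunctor_ext (obj : C → D) {f g : ∀ X Y : C, (X ⟶[V] Y) ⟶ obj X ⟶[V] obj Y}
    {h₁ h₂ h₃ h₄} (h : ∀ X Y, f X Y = g X Y) :
    (⟨obj, f, h₁, h₂⟩ : EnrichedFunctor V C D) = ⟨obj, g, h₃, h₄⟩ := by
  obtain rfl : f = g := funext fun X => funext fun Y => h X Y
  rfl

theorem enrichedFunctor_id_comp (F : EnrichedFunctor V C D) :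
    (EnrichedFunctor.id V C).comp V F = F :=
  enrichedFunctor_ext _ fun _ _ => Category.id_comp _

theorem enrichedFunctor_comp_id (F : EnrichedFunctor V C D) :
    F.comp V (EnrichedFunctor.id V D) = F :=
  enrichedFunctor_ext _ fun _ _ => Category.comp_id _

theorem enrichedFunctor_assoc (F : EnrichedFunctor V C D) (G : EnrichedFunctor V D E)
    (H : EnrichedFunctor V E E') : (F.comp V G).comp V H = F.comp V (G.comp V H) :=
  enrichedFunctor_ext _ fun _ _ => Category.assoc _ _ _

end

theorem pathFunctor_id (n : SimplexCategory) :
    pathFunctor.{u} (𝟙 n) = EnrichedFunctor.id _ (PathObj n) :=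
  enrichedFunctor_ext _ fun _ _ => MonoidalOpposite.hom_ext (pathStrat_hom_ext fun _ _ _ =>
    congrArg ULift.up (PathHom.id_map _))

theorem pathFunctor_comp {n m k : SimplexCategory} (α : n ⟶ m) (β : m ⟶ k) :
    pathFunctor.{u} (α ≫ β) = (pathFunctor.{u} α).comp _ (pathFunctor.{u} β) :=
  enrichedFunctor_ext _ fun _ _ => MonoidalOpposite.hom_ext (pathStrat_hom_ext fun _ _ _ =>
    congrArg ULift.up (PathHom.comp_map α β _))

/-! ### The nerve of a category enriched in stratified sets -/

/-- A category enriched in `(Strat, ⊗, Δ[0])`, with composition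
`E(b, c) ⊗ E(a, b) ⟶ E(a, c)`. -/
structure StratCat : Type (max (u + 1) (w + 1)) where
  carrier : Type w
  str : EnrichedCategory Strat.{u}ᴹᵒᵖ carrier

attribute [instance] StratCat.str

/-- The category of categories enriched in `(Strat, ⊗, Δ[0])` and enriched functors. -/
instance : Category StratCat.{u, w} where
  Hom C D := EnrichedFunctor Strat.{u}ᴹᵒᵖ C.carrier D.carrier
  id C := EnrichedFunctor.id _ C.carrier
  comp F G := F.comp _ G
  id_comp := enrichedFunctor_id_comp
  comp_id := enrichedFunctor_comp_id
  assoc := enrichedFunctor_assoc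

/-- The nerve functor: the `n`-simplices of the nerve of `E` are the enriched functors from the
generic homotopy coherent `n`-path to `E`. -/
noncomputable def stratNerve : StratCat.{u, w} ⥤ SSet.{max u w} where
  obj E :=
    { obj := fun n => EnrichedFunctor Strat.{u}ᴹᵒᵖ (PathObj n.unop) E.carrier
      map := fun α => ↾fun F => (pathFunctor.{u} α.unop).comp _ F
      map_id := fun n => by
        ext F
        exact (congrArg (fun G => G.comp _ F) (pathFunctor_id n.unop)).trans
          (enrichedFunctor_id_comp F)
      map_comp := fun α β => by
        ext F
        exact (congrArg (fun G => G.comp _ F) (pathFunctor_comp β.unop α.unop)).trans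
          (enrichedFunctor_assoc _ _ F) }
  map G :=
    { app := fun _ => ↾fun F => F.comp _ G
      naturality := fun _ _ α => by
        ext F
        exact enrichedFunctor_assoc (pathFunctor α.unop) F G }
  map_id E := by
    ext n F
    exact enrichedFunctor_comp_id F
  map_comp G H := by
    ext n F
    exact (enrichedFunctor_assoc F G H).symm

end StratGray

/-! An enriched functor is determined by its values on objects and on single simplices of homs, so
it is enough to exhibit each of these inside a simplex of the nerve. Objects are seen by the
`0`-simplices `constPath`.

Let `y` be an `n`-simplex of the hom from `X` to `Y`. It is found inside an enriched functor on the
generic path of length `n + 1`, namely `classify`, which sends `0, …, n` to `X` and `n + 1` to `Y`.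
Homs among `0, …, n`, and the endomorphisms of `n + 1`, go to identities; a hom from `r ≤ n` to `n +
1` is first collapsed to `Δ[n]` and then mapped by the simplex `y`. The collapse sends a tuple to `n
- i`, where `i` is its last zero up to `n`, or `r` if there is none.

Three facts make this work. The collapse is stratified: a simplex with nondegenerate image has
strictly decreasing last zeros, and these are jumps of the kind that `pathStrat_notMem_thin` demands
of a non-thin simplex. The collapse is unchanged by precomposition with paths inside `0, …, n`
(`PathHom.lastZero_comp`), which gives functoriality (`classifyMap_comp`). Finally it hits the
identity simplex of `Δ[n]`, at `stair`, so `y` itself is a value of the functor (`collapse_stair`).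
Two enriched functors with the same nerve therefore agree on `y`. -/

namespace StratGray

/-! ### Maps to the unit, from the empty stratified set and from standard simplices -/

/-- The map from a stratified set to the unit `Δ[0]`. -/
def Strat.toUnit (X : Strat.{u}) : X ⟶ 𝟙_ Strat.{u} where
  toMap := CartesianMonoidalCategory.toUnit X.toSSet
  map_thin n x hx := by
    -- Every simplex of `Δ[0]` of positive dimension is degenerate, and no `0`-simplex is thin.
    refine (Strat.mem_degenerate_unit _).2 (Nat.pos_of_ne_zero ?_)
    rintro rfl
    rw [X.thin_zero] at hx
    exact hx

theorem Strat.toUnit_unique {X : Strat.{u}} (f g : X ⟶ 𝟙_ Strat.{u}) : f = g :=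
  Strat.hom_ext (CartesianMonoidalCategory.toUnit_unique (Strat.Hom.toMap f) (Strat.Hom.toMap g))

/-- The map from a stratified set without simplices. -/
def Strat.ofIsEmpty (X Y : Strat.{u}) (h : ∀ m, IsEmpty (X.toSSet.obj m)) : X ⟶ Y where
  toMap :=
    { app := fun m => ↾fun x => ((h m).false x).elim
      naturality := fun m _ _ => by
        ext x
        exact ((h m).false x).elim }
  map_thin n x := ((h (op ⦋n⦌)).false x).elim

theorem Strat.hom_ext_of_isEmpty {X Y : Strat.{u}} (h : ∀ m, IsEmpty (X.toSSet.obj m))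
    (f g : X ⟶ Y) : f = g := by
  refine Strat.hom_ext ?_
  ext m x
  exact ((h m).false x).elim

/-- The stratified map out of a minimally stratified standard simplex classifying a simplex. -/
def Strat.ofSimplex {X : Strat.{u}} {n : ℕ} (x : X.toSSet _⦋n⦌) :
    Strat.minimal (Δ[n] : SSet.{u}) ⟶ X where
  toMap := SSet.yonedaEquiv.symm x
  map_thin m _ hy := X.degenerate_subset m (SSet.degenerate_app_apply hy _)

theorem Strat.ofSimplex_id {X : Strat.{u}} {n : ℕ} (x : X.toSSet _⦋n⦌) :
    (Strat.Hom.toMap (Strat.ofSimplex x)).app (op ⦋n⦌)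
      (SSet.stdSimplex.objEquiv.symm (𝟙 _)) = x :=
  SSet.yonedaEquiv.apply_symm_apply x

theorem pathStrat_isEmpty {r s : ℕ} (h : s < r) (m : SimplexCategoryᵒᵖ) :
    IsEmpty ((pathStrat.{u} r s).toSSet.obj m) :=
  ⟨fun x => absurd ((x : (pathSSet.{u} r s).obj m).obj 0).down.le (not_le.2 h)⟩

/-! ### Collapsing paths onto `Δ[n]` by their last zero -/

/-- The largest index `i ≤ n` which is either the source or an index with ordinate zero. -/
def PathHom.lastZero (n : ℕ) {r s : ℕ} (a : PathHom r s) : ℕ :=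
  Nat.findGreatest (fun i => a.coord i = 0 ∨ i = r) n

theorem PathHom.lastZero_anti (n : ℕ) {r s : ℕ} {a b : PathHom r s} (h : a ≤ b) :
    b.lastZero n ≤ a.lastZero n :=
  Nat.findGreatest_mono_left (fun i hi => hi.imp_left (PathHom.le_iff_zero.1 h i)) n

/-- When the last zero drops, it is itself an index at which the ordinate jumps from `0` to `1`.
This supplies the jumps required of a non-thin simplex of tuples. -/
theorem PathHom.coord_lastZero (n : ℕ) {r s : ℕ} {a b : PathHom r s}
    (h : b.lastZero n < a.lastZero n) :
    a.coord (a.lastZero n) = 0 ∧ b.coord (a.lastZero n) = 1 := by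
  have hn : a.lastZero n ≤ n := Nat.findGreatest_le n
  have hb : ¬ (b.coord (a.lastZero n) = 0 ∨ a.lastZero n = r) :=
    Nat.findGreatest_is_greatest h hn
  rw [not_or] at hb
  -- The strict inequality excludes the default value `0` of `Nat.findGreatest`.
  have ha : a.coord (a.lastZero n) = 0 ∨ a.lastZero n = r :=
    Nat.findGreatest_of_ne_zero (P := fun i => a.coord i = 0 ∨ i = r) rfl (by omega)
  exact ⟨ha.resolve_right hb.2, (PathHom.coord_eq_one_iff _ _).2 hb.1⟩

/-- All zeros of `a` are at most `s`, and `s` already counts as a candidate for `b`. Conversely `s`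
remains a candidate for the composite: either `a` ends with a zero there, or `r = s`. -/
theorem PathHom.lastZero_comp (n : ℕ) {r s t : ℕ} (hs : s ≤ n) (b : PathHom s t)
    (a : PathHom r s) : (comp b a).lastZero n = b.lastZero n := by
  refine le_antisymm ?_ ?_
  · have hle : s ≤ b.lastZero n := Nat.le_findGreatest hs (Or.inr rfl)
    by_contra! hlt
    have hn : (comp b a).lastZero n ≤ n := Nat.findGreatest_le n
    have h1 : (comp b a).coord ((comp b a).lastZero n) = 0 ∨ (comp b a).lastZero n = r :=
      Nat.findGreatest_of_ne_zero (P := fun i => (comp b a).coord i = 0 ∨ i = r) rfl (by omega)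
    have h2 : ¬ (b.coord ((comp b a).lastZero n) = 0 ∨ (comp b a).lastZero n = s) :=
      Nat.findGreatest_is_greatest hlt hn
    have hrs := a.le
    rcases h1 with h1 | h1
    · rcases (comp_coord_eq_zero _ _ _).1 h1 with h1 | h1
      · exact h2 (Or.inl h1)
      · have := (a.mem_of_coord_eq_zero h1).2
        omega
    · omega
  · refine Nat.findGreatest_mono_left (fun i hi => ?_) n
    rw [comp_coord_eq_zero]
    rcases hi with hi | rfl
    · exact Or.inl (Or.inl hi)
    · rcases a.le.eq_or_lt with h | h
      · exact Or.inr h.symm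
      · exact Or.inl (Or.inr (a.coord_last h))

/-- A loop has no zero ordinates, so composing with it changes no candidate. This is applied to
loops at the last object `n + 1`, which `PathHom.lastZero_comp` does not cover. -/
theorem PathHom.lastZero_loop_comp (n : ℕ) {r s t : ℕ} (hst : s = t) (b : PathHom s t)
    (a : PathHom r s) : (comp b a).lastZero n = a.lastZero n := by
  have h : (fun i => (comp b a).coord i = 0 ∨ i = r) = fun i => a.coord i = 0 ∨ i = r := by
    funext i
    have : ¬ b.coord i = 0 := fun h => by
      have := b.mem_of_coord_eq_zero h
      omega
    rw [comp_coord_eq_zero]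
    simp [this]
  unfold lastZero
  simp only [h]

/-- The simplicial map collapsing tuples to the standard simplex, by the position of their leading
block of ones. -/
def collapseMap (n r s : ℕ) : pathSSet.{u} r s ⟶ (Δ[n] : SSet.{u}) where
  app _ := ↾fun x => SSet.stdSimplex.objMk
    ⟨fun v => ⟨n - (x.obj v).down.lastZero n, Nat.lt_succ_of_le (Nat.sub_le _ _)⟩,
      fun _ _ h => Fin.mk_le_mk.2 (Nat.sub_le_sub_left
        (PathHom.lastZero_anti n (x.monotone h)) n)⟩
  naturality _ _ _ := rfl

/-- The collapse of tuples to the standard simplex is stratified. -/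
def collapse (n r s : ℕ) : pathStrat.{u} r s ⟶ Strat.minimal (Δ[n] : SSet.{u}) where
  toMap := collapseMap n r s
  map_thin m x hx := by
    change (pathSSet.{u} r s) _⦋m⦌ at x
    by_contra hcon
    have hmono := (SSet.stdSimplex.mem_nonDegenerate_iff_strictMono _).1 hcon
    have key : ∀ i j : Fin (m + 1), i < j →
        (x.obj j).down.lastZero n < (x.obj i).down.lastZero n := fun i j hij => by
      have h : n - (x.obj i).down.lastZero n < n - (x.obj j).down.lastZero n := hmono hij
      omega
    -- The jump at step `l` is taken at the last zero of the `l`-th vertex. The default `0` is never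
    -- inspected, since only `l < m` matters.
    refine (pathStrat_notMem_thin x).2 ⟨fun l => if h : l < m + 1 then
      (x.obj ⟨l, h⟩).down.lastZero n else 0, fun l l' hl hl' => ?_, fun l hl => ?_⟩ hx
    · beta_reduce
      erw [dif_pos (show l < m + 1 by omega), dif_pos (show l' < m + 1 by omega)]
      exact key _ _ (Fin.mk_lt_mk.2 hl)
    · beta_reduce
      erw [dif_pos (show l < m + 1 by omega)]
      exact PathHom.coord_lastZero n (key _ _ (Fin.mk_lt_mk.2 (Nat.lt_succ_self l)))

theorem collapse_hom_ext {X : Strat.{u}} {n : ℕ} {f g : X ⟶ Strat.minimal (Δ[n] : SSet.{u})}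
    (h : ∀ (m : ℕ) (x : X.toSSet _⦋m⦌) (v : Fin (m + 1)),
      ((show (Δ[n] : SSet.{u}) _⦋m⦌ from (Strat.Hom.toMap f).app _ x) v : ℕ) =
        (show (Δ[n] : SSet.{u}) _⦋m⦌ from (Strat.Hom.toMap g).app _ x) v) : f = g := by
  refine Strat.hom_ext ?_
  ext m x
  induction m using Opposite.rec with | _ m
  induction m using SimplexCategory.rec with | _ m
  exact SSet.stdSimplex.ext _ _ fun v => Fin.ext (h m x v)

/-- This compatibility with precomposition permits homs among `0, …, n` to be sent to an identity.
-/
theorem pathComp_collapse {n r s t : ℕ} (hs : s ≤ n) :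
    pathComp.{u} r s t ≫ collapse n r t =
      (collapse n s t ⊗ₘ (pathStrat.{u} r s).toUnit) ≫ (ρ_ _).hom :=
  collapse_hom_ext fun _ _ _ => congrArg (n - ·) (PathHom.lastZero_comp n hs _ _)

theorem pathComp_collapse_loop {n r s t : ℕ} (hst : s = t) :
    pathComp.{u} r s t ≫ collapse n r t =
      ((pathStrat.{u} s t).toUnit ⊗ₘ collapse n r s) ≫ (λ_ _).hom :=
  collapse_hom_ext fun _ _ _ => congrArg (n - ·) (PathHom.lastZero_loop_comp n hst _ _)

/-! ### A chain of tuples collapsing onto the identity simplex -/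

/-- The chain of tuples `a⁰ < ⋯ < aⁿ` for which the zeros of `aˡ` are `n + 1` and the indices
`1, …, n - l`. -/
def stair (n : ℕ) : (pathSSet.{u} 0 (n + 1)) _⦋n⦌ :=
  Monotone.functor
    (f := fun l : Fin (n + 1) => ULift.up
      { coord := fun i => if (0 < i ∧ i + l ≤ n) ∨ i = n + 1 then 0 else 1
        le := Nat.zero_le _
        coord_eq_one := fun i hi => if_neg (by omega)
        coord_last := fun _ => if_pos (Or.inr rfl) })
    (fun l l' h => PathHom.le_iff_zero.2 fun i hi => by
      have h' : (l : ℕ) ≤ l' := h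
      dsimp only at hi ⊢
      split_ifs at hi ⊢ <;> first | rfl | (exfalso; omega))

theorem collapse_stair (n : ℕ) :
    (Strat.Hom.toMap (collapse.{u} n 0 (n + 1))).app (op ⦋n⦌) (stair n) =
      SSet.stdSimplex.objEquiv.symm (𝟙 _) := by
  refine SSet.stdSimplex.ext _ _ (fun v => Fin.ext ?_)
  have hv := v.isLt
  have key : (((stair.{u} n).obj v).down.lastZero n) = n - v := by
    -- For `v < n` the index `n - v` is positive and is a zero of the tuple; for `v = n` the value
    -- `0` is the default and needs no check.
    refine (Nat.findGreatest_eq_iff).2 ⟨Nat.sub_le _ _, fun h => Or.inl ?_, fun i h1 h2 h3 => ?_⟩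
    · exact if_pos (Or.inl ⟨by omega, by omega⟩)
    · rcases h3 with h3 | h3
      · have : (if (0 < i ∧ i + v ≤ n) ∨ i = n + 1 then (0 : Fin 2) else 1) = 0 := h3
        rw [if_neg (by omega)] at this
        exact absurd this (by decide)
      · omega
  change n - ((stair.{u} n).obj v).down.lastZero n = (v : ℕ)
  rw [key]
  omega

/-! ### Unit laws for arrows that factor through an identity -/

section

variable {V : Type*} [Category* V] [MonoidalCategory V] {C : Type*} [EnrichedCategory V C]

/-- The factor through `eId` is slid past `g` by the interchange law and then absorbed by the unit
law of the enriched category. -/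
theorem tensor_eId_eComp_left {X Y : C} {A B : V} (f : A ⟶ 𝟙_ V) (g : B ⟶ (X ⟶[V] Y)) :
    ((f ≫ eId V X) ⊗ₘ g) ≫ eComp V X X Y = (f ⊗ₘ 𝟙 B) ≫ (λ_ B).hom ≫ g := by
  have h : eId V X ▷ (X ⟶[V] Y) ≫ eComp V X X Y = (λ_ _).hom := by
    rw [← cancel_epi (λ_ (X ⟶[V] Y)).inv, e_id_comp, Iso.inv_hom_id]
  have : ((f ≫ eId V X) ⊗ₘ g) = f ▷ B ≫ (𝟙_ V) ◁ g ≫ eId V X ▷ _ := by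
    rw [whisker_exchange, MonoidalCategory.tensorHom_def, comp_whiskerRight, Category.assoc]
  rw [this]
  simp only [Category.assoc, h, tensorHom_id, leftUnitor_naturality]

theorem tensor_eId_eComp_right {X Y : C} {A B : V} (f : A ⟶ 𝟙_ V) (g : B ⟶ (X ⟶[V] Y)) :
    (g ⊗ₘ (f ≫ eId V Y)) ≫ eComp V X Y Y = (𝟙 B ⊗ₘ f) ≫ (ρ_ B).hom ≫ g := by
  have h : (X ⟶[V] Y) ◁ eId V Y ≫ eComp V X Y Y = (ρ_ _).hom := by
    rw [← cancel_epi (ρ_ (X ⟶[V] Y)).inv, e_comp_id, Iso.inv_hom_id]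
  have : (g ⊗ₘ (f ≫ eId V Y)) = B ◁ f ≫ g ▷ (𝟙_ V) ≫ _ ◁ eId V Y := by
    rw [MonoidalCategory.tensorHom_def, MonoidalCategory.whiskerLeft_comp, ← whisker_exchange_assoc]
  rw [this]
  simp only [Category.assoc, h, id_tensorHom, rightUnitor_naturality]

end

/-! ### The enriched functor classifying a simplex of a hom -/

/-- Whether an object of the generic path of length `n + 1` is the last one. -/
def isLast (n : ℕ) (r : ℕ) : Bool := decide (n < r)

theorem isLast_eq_false {n r : ℕ} (h : isLast n r = false) : r ≤ n :=
  not_lt.1 (of_decide_eq_false h)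

theorem isLast_eq_true {n r : ℕ} (h : isLast n r = true) : n < r :=
  of_decide_eq_true h

section

variable {C : Type w} [EnrichedCategory Strat.{u}ᴹᵒᵖ C]

/-- The action on homs of the enriched functor classifying a simplex of a hom. -/
def classifyMap (o : Bool → C) {n : ℕ}
    (x : Strat.minimal (Δ[n] : SSet.{u}) ⟶ (o false ⟶[Strat.{u}ᴹᵒᵖ] o true).unmop) (r s : ℕ)
    (p q : Bool) (hp : isLast n r = p) (hq : isLast n s = q) :
    MonoidalOpposite.mop (pathStrat.{u} r s) ⟶ (o p ⟶[Strat.{u}ᴹᵒᵖ] o q) :=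
  match p, q, hp, hq with
  | false, false, _, _ => (pathStrat.{u} r s).toUnit.mop ≫ eId Strat.{u}ᴹᵒᵖ (o false)
  | true, true, _, _ => (pathStrat.{u} r s).toUnit.mop ≫ eId Strat.{u}ᴹᵒᵖ (o true)
  | false, true, _, _ => (collapse n r s ≫ x).mop
  | true, false, hp, hq => (Strat.ofIsEmpty _ _ (pathStrat_isEmpty
      ((isLast_eq_false hq).trans_lt (isLast_eq_true hp)))).mop

theorem pathId_toUnit_eId (X : C) (r : ℕ) :
    (pathId.{u} r).mop ≫ (pathStrat.{u} r r).toUnit.mop ≫ eId Strat.{u}ᴹᵒᵖ X =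
      eId Strat.{u}ᴹᵒᵖ X := by
  have key : (pathId.{u} r).mop ≫ (pathStrat.{u} r r).toUnit.mop = 𝟙 (𝟙_ Strat.{u}ᴹᵒᵖ) :=
    MonoidalOpposite.hom_ext (Strat.toUnit_unique _ _)
  rw [reassoc_of% key]
  exact Category.id_comp _

/-- After the unit law both sides factor through the unit before `eId`, and maps into the unit are
unique. -/
theorem pathComp_toUnit_eId (X : C) (r s t : ℕ) :
    (pathComp.{u} r s t).mop ≫ (pathStrat.{u} r t).toUnit.mop ≫ eId Strat.{u}ᴹᵒᵖ X =
      (((pathStrat.{u} r s).toUnit.mop ≫ eId Strat.{u}ᴹᵒᵖ X) ⊗ₘ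
        ((pathStrat.{u} s t).toUnit.mop ≫ eId Strat.{u}ᴹᵒᵖ X)) ≫
        eComp Strat.{u}ᴹᵒᵖ X X X := by
  have key : (pathComp.{u} r s t).mop ≫ (pathStrat.{u} r t).toUnit.mop =
      ((pathStrat.{u} r s).toUnit.mop ⊗ₘ 𝟙 _) ≫ (λ_ _).hom ≫ (pathStrat.{u} s t).toUnit.mop :=
    MonoidalOpposite.hom_ext (Strat.toUnit_unique _ _)
  rw [tensor_eId_eComp_left, reassoc_of% key]

theorem classifyMap_id (o : Bool → C) {n : ℕ}
    (x : Strat.minimal (Δ[n] : SSet.{u}) ⟶ (o false ⟶[Strat.{u}ᴹᵒᵖ] o true).unmop) (r : ℕ)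
    (p : Bool) (hp : isLast n r = p) :
    (pathId.{u} r).mop ≫ classifyMap o x r r p p hp hp = eId Strat.{u}ᴹᵒᵖ (o p) := by
  cases p <;> exact pathId_toUnit_eId _ r

/-- The position of the three objects relative to the last one decides the case. Backward arrows
give an empty source, three objects on one side reduce to uniqueness of maps to the unit, and the
two mixed cases are the two compatibilities of the collapse with composition. -/
theorem classifyMap_comp (o : Bool → C) {n : ℕ}
    (x : Strat.minimal (Δ[n] : SSet.{u}) ⟶ (o false ⟶[Strat.{u}ᴹᵒᵖ] o true).unmop) (r s t : ℕ)
    (hs : s ≤ n + 1) (ht : t ≤ n + 1) (p q l : Bool) (hp : isLast n r = p) (hq : isLast n s = q)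
    (hl : isLast n t = l) :
    (pathComp.{u} r s t).mop ≫ classifyMap o x r t p l hp hl =
      (classifyMap o x r s p q hp hq ⊗ₘ classifyMap o x s t q l hq hl) ≫
        eComp Strat.{u}ᴹᵒᵖ (o p) (o q) (o l) := by
  match p, q, l, hp, hq, hl with
  | _, true, false, _, hq, hl =>
    exact MonoidalOpposite.hom_ext (Strat.hom_ext_of_isEmpty
      (fun m => ⟨fun (z : _ × _) => (pathStrat_isEmpty
        ((isLast_eq_false hl).trans_lt (isLast_eq_true hq)) m).false z.1⟩) _ _)
  | true, false, _, hp, hq, _ =>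
    exact MonoidalOpposite.hom_ext (Strat.hom_ext_of_isEmpty
      (fun m => ⟨fun (z : _ × _) => (pathStrat_isEmpty
        ((isLast_eq_false hq).trans_lt (isLast_eq_true hp)) m).false z.2⟩) _ _)
  | false, false, false, _, _, _ => exact pathComp_toUnit_eId _ r s t
  | true, true, true, _, _, _ => exact pathComp_toUnit_eId _ r s t
  | false, false, true, _, hq, _ =>
    refine Eq.trans ?_ (tensor_eId_eComp_left _ _).symm
    -- The monoidal opposite exchanges the factors, so the left unit law is read in `Strat` with the
    -- right unitor.
    refine MonoidalOpposite.hom_ext ?_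
    change pathComp r s t ≫ collapse n r t ≫ x =
      (𝟙 _ ⊗ₘ (pathStrat.{u} r s).toUnit) ≫ (ρ_ _).hom ≫ collapse n s t ≫ x
    rw [← Category.assoc, pathComp_collapse (isLast_eq_false hq)]
    simp [MonoidalCategory.tensorHom_def']
  | false, true, true, _, hq, hl =>
    refine Eq.trans ?_ (tensor_eId_eComp_right _ _).symm
    have h1 := isLast_eq_true hq
    have h2 := isLast_eq_true hl
    refine MonoidalOpposite.hom_ext ?_
    change pathComp r s t ≫ collapse n r t ≫ x =
      ((pathStrat.{u} s t).toUnit ⊗ₘ 𝟙 _) ≫ (λ_ _).hom ≫ collapse n r s ≫ x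
    -- Both `s` and `t` lie above `n` and are at most `n + 1`, hence coincide.
    rw [← Category.assoc, pathComp_collapse_loop (by omega)]
    simp [MonoidalCategory.tensorHom_def]

theorem PathObj.val_le {n : ℕ} (r : PathObj ⦋n⦌) : r.val ≤ n :=
  Nat.le_of_lt_succ (Fin.isLt (n := n + 1) r)

/-- The enriched functor from the generic path of length `n + 1` classifying an `n`-simplex of a
hom: all objects but the last one are sent to the source. -/
def classify (o : Bool → C) {n : ℕ}
    (x : Strat.minimal (Δ[n] : SSet.{u}) ⟶ (o false ⟶[Strat.{u}ᴹᵒᵖ] o true).unmop) :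
    EnrichedFunctor Strat.{u}ᴹᵒᵖ (PathObj ⦋n + 1⦌) C where
  obj r := o (isLast n r.val)
  map r s := classifyMap o x r.val s.val _ _ rfl rfl
  map_id r := classifyMap_id o x r.val _ rfl
  map_comp r s t := classifyMap_comp o x r.val s.val t.val s.val_le t.val_le _ _ _ rfl rfl rfl

end

/-! ### Enriched functors are detected by the nerve -/

/-- Every simplex of every hom of `C` is the image of `stair` under some `classify o x`, so
agreement on classifying functors is agreement on homs. -/
theorem enrichedFunctor_eq_of_classify {C D : Type w} [EnrichedCategory Strat.{u}ᴹᵒᵖ C]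
    [EnrichedCategory Strat.{u}ᴹᵒᵖ D] (F G : EnrichedFunctor Strat.{u}ᴹᵒᵖ C D)
    (hobj : F.obj = G.obj)
    (h : ∀ (n : ℕ) (o : Bool → C)
      (x : Strat.minimal (Δ[n] : SSet.{u}) ⟶ (o false ⟶[Strat.{u}ᴹᵒᵖ] o true).unmop),
      (classify o x).comp _ F = (classify o x).comp _ G) : F = G := by
  obtain ⟨obj, f, h₁, h₂⟩ := F
  obtain ⟨obj', g, h₃, h₄⟩ := G
  -- With the object maps identified first, the two hom maps have the same type and no transport is
  -- needed.
  obtain rfl : obj = obj' := hobj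
  refine enrichedFunctor_ext obj fun X Y => MonoidalOpposite.hom_ext (Strat.hom_ext ?_)
  ext m y
  induction m using Opposite.rec with | _ m
  induction m using SimplexCategory.rec with | _ n
  let o : Bool → C := fun b => bif b then Y else X
  let x : Strat.minimal (Δ[n] : SSet.{u}) ⟶ (o false ⟶[Strat.{u}ᴹᵒᵖ] o true).unmop :=
    Strat.ofSimplex (X := (X ⟶[Strat.{u}ᴹᵒᵖ] Y).unmop) y
  have hmap : (fun r s => ((classify o x).comp _ ⟨obj, f, h₁, h₂⟩).map r s) =
      fun r s => ((classify o x).comp _ ⟨obj, g, h₃, h₄⟩).map r s := by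
    have := h n o x
    simp only [EnrichedFunctor.comp, EnrichedFunctor.mk.injEq, heq_eq_eq, true_and] at this
    exact this
  -- The Booleans are generalised so that they can be set to `false` and `true` for the objects `0`
  -- and `n + 1`, which selects the collapsing branch of `classifyMap`.
  have key : ∀ (p q : Bool) (r s : PathObj ⦋n + 1⦌) (hp : isLast n r.val = p)
      (hq : isLast n s.val = q),
      classifyMap o x r.val s.val p q hp hq ≫ f (o p) (o q) =
        classifyMap o x r.val s.val p q hp hq ≫ g (o p) (o q) := by
    rintro _ _ r s rfl rfl
    exact congrFun (congrFun hmap r) s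
  have h5 := key false true (0 : Fin (n + 2)) (Fin.last (n + 1))
    (decide_eq_false (Nat.not_lt_zero n)) (decide_eq_true (Nat.lt_succ_self n))
  have h6 := congrArg (fun k => (Strat.Hom.toMap k.unmop).app (op ⦋n⦌) (stair.{u} n)) h5
  -- The stair collapses to the identity simplex of `Δ[n]`, which `x` sends to the simplex `y` that
  -- it classifies.
  have h7 : (Strat.Hom.toMap (collapse.{u} n 0 (n + 1) ≫ x)).app (op ⦋n⦌) (stair n) = y :=
    (congrArg ((Strat.Hom.toMap x).app (op ⦋n⦌)) (collapse_stair n)).trans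
      (Strat.ofSimplex_id (X := (X ⟶[Strat.{u}ᴹᵒᵖ] Y).unmop) y)
  have h8 : ∀ k : (X ⟶[Strat.{u}ᴹᵒᵖ] Y) ⟶ (obj X ⟶[Strat.{u}ᴹᵒᵖ] obj Y),
      (Strat.Hom.toMap k.unmop).app (op ⦋n⦌)
        ((Strat.Hom.toMap (collapse.{u} n 0 (n + 1) ≫ x)).app (op ⦋n⦌) (stair n)) =
      (Strat.Hom.toMap k.unmop).app (op ⦋n⦌) y := fun k => congrArg _ h7
  exact (h8 (f X Y)).symm.trans (h6.trans (h8 (g X Y)))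

/-- The enriched functor from the generic path of length zero at an object. -/
def constPath {C : Type w} [EnrichedCategory Strat.{u}ᴹᵒᵖ C] (X : C) :
    EnrichedFunctor Strat.{u}ᴹᵒᵖ (PathObj ⦋0⦌) C where
  obj _ := X
  map r s := (pathStrat.{u} r.val s.val).toUnit.mop ≫ eId Strat.{u}ᴹᵒᵖ X
  map_id r := pathId_toUnit_eId X r.val
  map_comp r s t := pathComp_toUnit_eId X r.val s.val t.val

end StratGray

theorem mainTheorem2 : StratGray.stratNerve.{u, w}.Faithful where
  map_injective {C D F G} h := by
    -- The equality of nerve maps is evaluated at each simplex `P` of the nerve of `C`.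
    have hcomp : ∀ (n : ℕ)
        (P : EnrichedFunctor StratGray.Strat.{u}ᴹᵒᵖ (StratGray.PathObj ⦋n⦌) C.carrier),
        P.comp _ F = P.comp _ G := fun n P =>
      congrArg (fun k => k.app (op ⦋n⦌) P) h
    refine StratGray.enrichedFunctor_eq_of_classify F G (funext fun X => ?_)
      fun n o x => hcomp (n + 1) (StratGray.classify o x)
    exact congrArg (fun P => P.obj (0 : Fin 1)) (hcomp 0 (StratGray.constPath X))
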